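/- Let $G$ be a countable discrete group with a sofic approximation $\sigma_k\colon G\to \mathrm{Sym}(d_k)$, $d_k\ge 1$; that is, $u_{d_k}(\{j:\sigma_k(g)\sigma_k(h)(j)=\sigma_k(gh)(j)\})\to 1$ for all $g,h\in G$, and $u_{d_k}(\{j:\sigma_k(g)(j)\ne\sigma_k(h)(j)\})\to 1$ for all $g\neq h$, where $u_{d}(A)=|A|/d$ for $A\subseteq\{1,\dots,d\}$. Suppose that $(\sigma_k)_k$ has ergodic commutant: for every sequence $A_k\subseteq\{1,\dots,d_k\}$ with $\liminf_{k\to\infty} u_{d_k}(A_k)>0$ and every $\varepsilon>0$ there are $r\in\mathbb N$ and sequences $(\tau_{1,k})_k,\dots,(\tau_{r,k})_k\in\prod_k \mathrm{Sym}(d_k)$ such that $\lim_{k\to\infty}u_{d_k}(\{j:\sigma_k(g)\tau_{i,k}(j)\neq\tau_{i,k}\sigma_k(g)(j)\})=0$ for all $g\in G$ and $1\le i\le r$, and $\liminf_{k\to\infty}u_{d_k}\big(\bigcup_{i=1}^r\tau_{i,k}(A_k)\big)\ge 1-\varepsilon$. Let $G$ act by continuous automorphisms on a compact metrizable group $X$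 with Haar probability measure $m_X$, and let $\rho$ be a compatible metric on $X$. For $\phi,\psi\in X^{d}$ put $\rho_2(\phi,\psi)=\big(\frac1d\sum_{j=1}^d\rho(\phi(j),\psi(j))^2\big)^{1/2}$, and $\rho_2(\phi,Y^d)=\inf_{\psi\in Y^d}\rho_2(\phi,\psi)$. A sequence $(\phi_k)_k\in\prod_k X^{d_k}$ is a sequence of topological microstates if $u_{d_k}(\{j:(g\phi_k(j),\phi_k(\sigma_k(g)(j)))\in U\})\to1$ for every $g\in G$ and every neighbourhood $U$ of the diagonal in $X\times X$. Borel probability measures $\mu_k$ on $X^{d_k}$ are asymptotically supported on topological microstates if for every $g\in G$, every open neighbourhood $U$ of the diagonal and every $\varepsilon>0$, $$\mu_k\big(\{\phi: u_{d_k}(\{j:(\phi(\sigma_k(g)(j)),g\phi(j))\in U\})\ge 1-\varepsilon\}\big)\to 1,$$ and they locally weak$^*$-converge to $m_X$ if for every weak$^*$-neighbourhood $\mathcal O$ of $m_X$ we have $u_{d_k}(\{j:\mu_{k,j}\in\mathcal O\})\to 1$, where $\mu_{k,j}$ is the $j$-th marginal of $\mu_k$. All limits are as $k\to\infty$. Then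 the following are equivalent. (i) There is no sequence of Borel probability measures $\mu_k$ on $X^{d_k}$ that is asymptotically supported on topological microstates and locally weak$^*$-converges to $m_X$. (ii) There is a proper closed $G$-invariant subgroup $Y$ of $X$ such that for every sequence $(\phi_k)_k\in\prod_k X^{d_k}$ of topological microstates there is a strictly increasing sequence $(k_l)_l$ of natural numbers with $\lim_{l\to\infty}\rho_2(\phi_{k_l},Y^{d_{k_l}})=0$. -/

import Mathlib

open MeasureTheory Filter Topology

noncomputable section

namespace SoficAction

/-- The uniform probability `u_d(A) = |A| / d` of a subset `A` of a `d`-element set. -/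
def unif {d : ℕ} (A : Set (Fin d)) : ℝ := (A.ncard : ℝ) / (d : ℝ)

/-- The normalized Hamming distance between two permutations of a `d`-element set. -/
def hamming {d : ℕ} (p q : Equiv.Perm (Fin d)) : ℝ := unif {j | p j ≠ q j}

/-- `σ k : G → Sym(d k)` is a sofic approximation of `G`: asymptotically multiplicative and
asymptotically free. The maps `σ k` need not be homomorphisms. -/
structure IsSoficApproximation {G : Type*} [Group G] (d : ℕ → ℕ)
    (σ : ∀ k, G → Equiv.Perm (Fin (d k))) : Prop where
  pos : ∀ k, 0 < d k
  mul : ∀ g h : G,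
    Tendsto (fun k => unif {j | σ k g (σ k h j) = σ k (g * h) j}) atTop (𝓝 1)
  free : ∀ g h : G, g ≠ h →
    Tendsto (fun k => unif {j | σ k g j ≠ σ k h j}) atTop (𝓝 1)

/-- The commutant of `(σ k)`: sequences of permutations that asymptotically commute, in Hamming
distance, with `σ k g` for each `g`. -/
def commutant {G : Type*} (d : ℕ → ℕ) (σ : ∀ k, G → Equiv.Perm (Fin (d k))) :
    Set (∀ k, Equiv.Perm (Fin (d k))) :=
  {τ | ∀ g : G, Tendsto (fun k => hamming (σ k g * τ k) (τ k * σ k g)) atTop (𝓝 0)}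

/-- `(σ k)` has ergodic commutant: finitely many elements of the commutant move any
sequence of subsets with asymptotically positive density onto almost everything. -/
def HasErgodicCommutant {G : Type*} (d : ℕ → ℕ) (σ : ∀ k, G → Equiv.Perm (Fin (d k))) : Prop :=
  ∀ A : ∀ k, Set (Fin (d k)), 0 < liminf (fun k => unif (A k)) atTop →
    ∀ ε : ℝ, 0 < ε →
      ∃ (r : ℕ) (τ : Fin r → ∀ k, Equiv.Perm (Fin (d k))),
        (∀ i, τ i ∈ commutant d σ) ∧
          1 - ε ≤ liminf (fun k => unif (⋃ i, τ i k '' A k)) atTop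

/-- `φ k : {1, …, d k} → X` is a sequence of topological microstates for the action of `G` on `X`
with respect to `(σ k)`. -/
def IsTopologicalMicrostates {G X : Type*} [SMul G X] [TopologicalSpace X] (d : ℕ → ℕ)
    (σ : ∀ k, G → Equiv.Perm (Fin (d k))) (φ : ∀ k, Fin (d k) → X) : Prop :=
  ∀ g : G, ∀ U ∈ 𝓝ˢ (Set.diagonal X),
    Tendsto (fun k => unif {j | (g • φ k j, φ k (σ k g j)) ∈ U}) atTop (𝓝 1)

/-- The measures `μ k` on `X ^ d k` are asymptotically supported on topological microstates. -/
def AsympSupportedOnMicrostates {G X : Type*} [SMul G X] [TopologicalSpace X]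
    [MeasurableSpace X] (d : ℕ → ℕ) (σ : ∀ k, G → Equiv.Perm (Fin (d k)))
    (μ : ∀ k, ProbabilityMeasure (Fin (d k) → X)) : Prop :=
  ∀ g : G, ∀ U : Set (X × X), IsOpen U → Set.diagonal X ⊆ U → ∀ ε : ℝ, 0 < ε →
    Tendsto (fun k => μ k {φ | 1 - ε ≤ unif {j | (φ (σ k g j), g • φ j) ∈ U}}) atTop (𝓝 1)

/-- The `j`-th marginal of a probability measure on `X ^ d`. -/
def marginal {X : Type*} [MeasurableSpace X] {d : ℕ} (μ : ProbabilityMeasure (Fin d → X))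
    (j : Fin d) : ProbabilityMeasure X :=
  μ.map (f := fun x => x j) (measurable_pi_apply j).aemeasurable

/-- Local weak* convergence of `μ k` on `X ^ d k` to `ν`: every weak* neighbourhood of `ν`
contains asymptotically almost all marginals of `μ k`. -/
def LocalWeakStarTendsto {X : Type*} [TopologicalSpace X] [MeasurableSpace X]
    [OpensMeasurableSpace X] (d : ℕ → ℕ) (μ : ∀ k, ProbabilityMeasure (Fin (d k) → X))
    (ν : ProbabilityMeasure X) : Prop :=
  ∀ O ∈ 𝓝 ν, Tendsto (fun k => unif {j | marginal (μ k) j ∈ O}) atTop (𝓝 1)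

/-- The Haar probability measure of a compact group. -/
def haarProb (X : Type*) [Group X] [TopologicalSpace X] [IsTopologicalGroup X] [CompactSpace X]
    [MeasurableSpace X] [BorelSpace X] : ProbabilityMeasure X :=
  ⟨Measure.haarMeasure ⊤, ⟨Measure.haarMeasure_self⟩⟩

/-- The normalized `ℓ²` metric on `X ^ d` coming from the metric of `X`. -/
def rho2 {X : Type*} [MetricSpace X] {d : ℕ} (φ ψ : Fin d → X) : ℝ :=
  Real.sqrt ((1 / (d : ℝ)) * ∑ j, dist (φ j) (ψ j) ^ 2)

/-- The distance, for `rho2`, of `φ` to the subset `Y ^ d` of `X ^ d`. -/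
def rho2ToPow {X : Type*} [MetricSpace X] {d : ℕ} (φ : Fin d → X) (Y : Set X) : ℝ :=
  ⨅ ψ : {ψ : Fin d → X // ∀ j, ψ j ∈ Y}, rho2 φ ψ.1

end SoficAction

end

/-! Call a point of `X` reachable along a filter if each of its neighbourhoods is visited by some
sequence of microstates with density bounded below along the filter. Microstates form a group under
pointwise multiplication and survive precomposition with inverses of commutant elements. Ergodicity
therefore turns one visit of positive density into finitely many microstates that together visit at
almost every index (`Charged.exists_finite_cover`), and reachable points form a closed `G`-invariant
subgroup.

If every point is reachable along `atTop`, a finite family of microstates takes nearly dense values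
at almost every index. A product of `n` independent uniform members is a random walk whose marginals
approach Haar measure at a rate independent of the index (`translateAverage_iterate_sub_le`); a
diagonal choice yields the measures. Otherwise some neighbourhood is uncharged along `atTop`, and
`exists_ultrafilter_not_charged` finds one ultrafilter along which it stays uncharged. The points
reachable along that ultrafilter form `Y`, and compactness drives all microstates towards `Y` along
it.

Conversely, the squared distance to a proper closed `Y` has positive Haar mean, so measures
converging to Haar give mass bounded below to configurations far from `Y`. `exists_microstates_far`
extracts microstates far from `Y` for all large `k`, which excludes every subsequence. -/

namespace SoficAction

/-! ### Normalized counting on finite index sets -/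

open scoped Classical in
theorem unif_eq_sum {d : ℕ} (A : Set (Fin d)) :
    unif A = (1 / (d : ℝ)) * ∑ j, if j ∈ A then (1 : ℝ) else 0 := by
  rw [Finset.sum_boole, unif, Set.ncard_eq_toFinset_card', div_eq_inv_mul, one_div]
  congr 3
  ext j
  simp

theorem unif_nonneg {d : ℕ} (A : Set (Fin d)) : 0 ≤ unif A := by
  unfold unif; positivity

theorem unif_mono {d : ℕ} {A B : Set (Fin d)} (h : A ⊆ B) : unif A ≤ unif B := by
  unfold unif
  gcongr
  exact Set.toFinite B

theorem unif_univ {d : ℕ} (hd : 0 < d) : unif (Set.univ : Set (Fin d)) = 1 := by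
  have : (d : ℝ) ≠ 0 := by positivity
  simp [unif, Set.ncard_univ, this]

theorem unif_empty {d : ℕ} : unif (∅ : Set (Fin d)) = 0 := by simp [unif]

theorem unif_le_one {d : ℕ} (A : Set (Fin d)) : unif A ≤ 1 := by
  unfold unif
  apply div_le_one_of_le₀ _ (by positivity)
  exact_mod_cast (Set.ncard_le_card A).trans_eq (by simp)

theorem unif_union_le {d : ℕ} (A B : Set (Fin d)) : unif (A ∪ B) ≤ unif A + unif B := by
  unfold unif
  rw [← add_div]
  gcongr
  exact_mod_cast Set.ncard_union_le A B

theorem unif_biUnion_le {d : ℕ} {ι : Type*} (t : Finset ι) (A : ι → Set (Fin d)) :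
    unif (⋃ i ∈ t, A i) ≤ ∑ i ∈ t, unif (A i) := by
  classical
  induction t using Finset.induction_on with
  | empty => simp [unif_empty]
  | insert i t hi ih =>
    rw [Finset.set_biUnion_insert, Finset.sum_insert hi]
    exact (unif_union_le _ _).trans (by gcongr)

theorem unif_compl {d : ℕ} (hd : 0 < d) (A : Set (Fin d)) : unif Aᶜ = 1 - unif A := by
  have h := Set.ncard_add_ncard_compl A
  have : (d : ℝ) ≠ 0 := by positivity
  unfold unif
  rw [eq_sub_iff_add_eq, ← add_div, div_eq_one_iff_eq this, add_comm]
  simp at h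
  exact_mod_cast h

theorem unif_preimage_perm {d : ℕ} (τ : Equiv.Perm (Fin d)) (A : Set (Fin d)) :
    unif {j | τ j ∈ A} = unif A := by
  unfold unif
  congr 2
  exact Set.ncard_preimage_of_injective_subset_range τ.injective (by simp)

theorem average_le_add_mul_unif {d : ℕ} (hd : 0 < d) (f : Fin d → ℝ) {a D : ℝ} (ha : 0 ≤ a)
    (hf : ∀ j, f j ≤ D) :
    (1 / (d : ℝ)) * ∑ j, f j ≤ a + D * unif {j | a ≤ f j} := by
  classical
  have hd' : (d : ℝ) ≠ 0 := by positivity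
  have h : ∑ j, f j ≤ ∑ j : Fin d, (a + D * if j ∈ {j | a ≤ f j} then 1 else 0) := by
    gcongr with j
    by_cases hj : a ≤ f j
    · simpa [hj] using (hf j).trans (le_add_of_nonneg_left ha)
    · simpa [hj] using (not_le.1 hj).le
  rw [Finset.sum_add_distrib, ← Finset.mul_sum] at h
  rw [unif_eq_sum]
  calc _ ≤ _ := mul_le_mul_of_nonneg_left h (by positivity)
    _ = _ := by simp; field_simp

theorem mul_unif_le_average {d : ℕ} (f : Fin d → ℝ) {a : ℝ} (hf : ∀ j, 0 ≤ f j) :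
    a * unif {j | a ≤ f j} ≤ (1 / (d : ℝ)) * ∑ j, f j := by
  classical
  rw [unif_eq_sum, mul_left_comm, Finset.mul_sum]
  gcongr with j
  by_cases hj : a ≤ f j
  · simp [hj]
  · simpa [hj] using hf j

/-! ### Asymptotically full density and diagonal selection -/

/-- The filter of sets of indices that have asymptotically full density. -/
def almostAll (d : ℕ → ℕ) : Filter (Σ k, Fin (d k)) where
  sets := {S | Tendsto (fun k => unif {j : Fin (d k) | ⟨k, j⟩ ∉ S}) atTop (𝓝 0)}
  univ_sets := by simp [unif_empty]
  sets_of_superset {S T} hS h := by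
    refine squeeze_zero (fun k => unif_nonneg _) (fun k => unif_mono ?_) hS
    exact fun j hj hjS => hj (h hjS)
  inter_sets {S T} hS hT := by
    have := Tendsto.add hS hT
    rw [add_zero] at this
    refine squeeze_zero (fun k => unif_nonneg _) (fun k => ?_) this
    refine (unif_mono ?_).trans (unif_union_le _ _)
    intro j hj
    by_contra h
    simp only [Set.mem_union, Set.mem_ofPred_eq, not_or, not_not] at h
    exact hj h

theorem eventually_almostAll {d : ℕ → ℕ} (hd : ∀ k, 0 < d k) {p : (Σ k, Fin (d k)) → Prop} :
    (∀ᶠ q in almostAll d, p q) ↔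
      Tendsto (fun k => unif {j : Fin (d k) | p ⟨k, j⟩}) atTop (𝓝 1) := by
  have h (k) : unif {j : Fin (d k) | ¬ p ⟨k, j⟩} = 1 - unif {j : Fin (d k) | p ⟨k, j⟩} :=
    unif_compl (hd k) _
  change Tendsto (fun k => unif {j : Fin (d k) | ¬ p ⟨k, j⟩}) atTop (𝓝 0) ↔ _
  simp only [h]
  constructor
  · intro H; simpa using H.const_sub 1
  · intro H; simpa using H.const_sub 1

theorem tendsto_perm_almostAll {d : ℕ → ℕ} (τ : ∀ k, Equiv.Perm (Fin (d k))) :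
    Tendsto (fun q : Σ k, Fin (d k) => (⟨q.1, τ q.1 q.2⟩ : Σ k, Fin (d k)))
      (almostAll d) (almostAll d) := by
  intro S hS
  change Tendsto (fun k => unif {j : Fin (d k) | τ k j ∈ {j | (⟨k, j⟩ : Σ k, Fin (d k)) ∉ S}})
    atTop (𝓝 0)
  simp only [unif_preimage_perm]
  exact hS

/-- If every finite subfamily of a countable family of conditions can eventually be satisfied,
then one sequence eventually satisfies each condition. -/
theorem exists_forall_eventually_of_finset {ι : Type*} [Countable ι] {β : ℕ → Type*}
    [∀ k, Nonempty (β k)] (P : ι → ∀ k, β k → Prop)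
    (h : ∀ s : Finset ι, ∀ᶠ k in atTop, ∃ b, ∀ i ∈ s, P i k b) :
    ∃ b : ∀ k, β k, ∀ i, ∀ᶠ k in atTop, P i k (b k) := by
  classical
  cases isEmpty_or_nonempty ι
  · exact ⟨fun k => Classical.arbitrary _, fun i => isEmptyElim i⟩
  obtain ⟨e, he⟩ := exists_surjective_nat ι
  let Q (k n : ℕ) : Prop := ∃ b, ∀ i ∈ (Finset.range n).image e, P i k b
  have hQ0 (k) : Q k 0 := ⟨Classical.arbitrary _, by simp⟩
  -- At index `k`, satisfy the longest initial segment of conditions, of length at most `k`, that is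
  -- satisfiable; length `0` always is.
  have hQ (k) : Q k (Nat.findGreatest (Q k) k) := Nat.findGreatest_spec (Nat.zero_le k) (hQ0 k)
  choose b hb using hQ
  refine ⟨b, fun i => ?_⟩
  obtain ⟨n, rfl⟩ := he i
  filter_upwards [h ((Finset.range (n + 1)).image e), eventually_ge_atTop (n + 1)] with k hk hnk
  apply hb k
  have := Nat.le_findGreatest hnk (show Q k (n + 1) from hk)
  exact Finset.mem_image_of_mem _ (Finset.mem_range.2 this)

/-! ### Operations preserving microstates -/

section Microstates

variable {G X : Type*} {d : ℕ → ℕ} {σ : ∀ k, G → Equiv.Perm (Fin (d k))}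

theorem isTopologicalMicrostates_iff [SMul G X] [UniformSpace X] [CompactSpace X]
    (hd : ∀ k, 0 < d k) {φ : ∀ k, Fin (d k) → X} :
    IsTopologicalMicrostates d σ φ ↔
      ∀ g : G, Tendsto (fun q : Σ k, Fin (d k) => (g • φ q.1 q.2, φ q.1 (σ q.1 g q.2)))
        (almostAll d) (uniformity X) := by
  rw [← nhdsSet_diagonal_eq_uniformity]
  refine forall_congr' fun g => ?_
  simp only [tendsto_def]
  refine forall₂_congr fun U _ => ?_
  exact (eventually_almostAll hd
    (p := fun q => (g • φ q.1 q.2, φ q.1 (σ q.1 g q.2)) ∈ U)).symm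

variable [MetricSpace X] [CompactSpace X]

theorem IsTopologicalMicrostates.tendsto_unif_not_dist_lt [SMul G X] (hd : ∀ k, 0 < d k)
    {φ : ∀ k, Fin (d k) → X} (hφ : IsTopologicalMicrostates d σ φ) (g : G) {δ : ℝ} (hδ : 0 < δ) :
    Tendsto (fun k => unif {j | ¬ dist (g • φ k j) (φ k (σ k g j)) < δ}) atTop (𝓝 0) := by
  have h := hφ g {p | dist p.1 p.2 < δ} (by
    rw [nhdsSet_diagonal_eq_uniformity]
    exact Metric.dist_mem_uniformity hδ)
  have h' := h.const_sub 1
  rw [sub_self] at h'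
  exact h'.congr fun k => (unif_compl (hd k) _).symm

theorem isTopologicalMicrostates_one [Group X] [Monoid G]
    [MulDistribMulAction G X] (hd : ∀ k, 0 < d k) :
    IsTopologicalMicrostates d σ (1 : ∀ k, Fin (d k) → X) := by
  rw [isTopologicalMicrostates_iff hd]
  intro g
  simp only [Pi.one_apply, smul_one]
  rw [tendsto_def]
  exact fun U hU => univ_mem' fun _ => refl_mem_uniformity hU

theorem IsTopologicalMicrostates.mul [Group X] [IsTopologicalGroup X] [Monoid G]
    [MulDistribMulAction G X] (hd : ∀ k, 0 < d k)
    {φ ψ : ∀ k, Fin (d k) → X} (hφ : IsTopologicalMicrostates d σ φ)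
    (hψ : IsTopologicalMicrostates d σ ψ) : IsTopologicalMicrostates d σ (φ * ψ) := by
  rw [isTopologicalMicrostates_iff hd] at *
  intro g
  have hu : UniformContinuous fun p : X × X => p.1 * p.2 :=
    CompactSpace.uniformContinuous_of_continuous continuous_mul
  have h : Tendsto (fun q : Σ k, Fin (d k) =>
      ((g • φ q.1 q.2, g • ψ q.1 q.2), (φ q.1 (σ q.1 g q.2), ψ q.1 (σ q.1 g q.2))))
      (almostAll d) (uniformity (X × X)) := by
    rw [uniformity_prod, tendsto_inf, tendsto_comap_iff, tendsto_comap_iff]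
    exact ⟨hφ g, hψ g⟩
  simpa only [Function.comp_def, ← smul_mul', Pi.mul_apply] using Tendsto.comp hu h

theorem IsTopologicalMicrostates.inv [Group X] [IsTopologicalGroup X] [Group G]
    [MulDistribMulAction G X] (hd : ∀ k, 0 < d k)
    {φ : ∀ k, Fin (d k) → X} (hφ : IsTopologicalMicrostates d σ φ) :
    IsTopologicalMicrostates d σ φ⁻¹ := by
  rw [isTopologicalMicrostates_iff hd] at *
  intro g
  have hu : UniformContinuous fun p : X => p⁻¹ :=
    CompactSpace.uniformContinuous_of_continuous continuous_inv
  simpa only [Function.comp_def, ← smul_inv', Pi.inv_apply] using Tendsto.comp hu (hφ g)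

/-- Finitely many exceptional sets of vanishing density have a union of vanishing density, so the
chosen member may vary arbitrarily with `k`. -/
theorem IsTopologicalMicrostates.select [SMul G X] (hd : ∀ k, 0 < d k) {ι : Type*} [Finite ι]
    {φ : ι → ∀ k, Fin (d k) → X} (hφ : ∀ i, IsTopologicalMicrostates d σ (φ i)) (i : ℕ → ι) :
    IsTopologicalMicrostates d σ (fun k => φ (i k) k) := by
  simp only [isTopologicalMicrostates_iff hd] at *
  intro g U hU
  have h : ∀ᶠ q : Σ k, Fin (d k) in almostAll d,
      ∀ i, (g • φ i q.1 q.2, φ i q.1 (σ q.1 g q.2)) ∈ U := eventually_all.2 fun i => hφ i g hU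
  exact h.mono fun q hq => hq (i q.1)

theorem IsTopologicalMicrostates.comp_commutant [Group G] [MulAction G X] (hd : ∀ k, 0 < d k)
    {φ : ∀ k, Fin (d k) → X} (hφ : IsTopologicalMicrostates d σ φ)
    {τ : ∀ k, Equiv.Perm (Fin (d k))} (hτ : τ ∈ commutant d σ) :
    IsTopologicalMicrostates d σ (fun k j => φ k ((τ k)⁻¹ j)) := by
  rw [isTopologicalMicrostates_iff hd] at *
  intro g
  have hinv := tendsto_perm_almostAll (fun k => (τ k)⁻¹)
  have hcomm : ∀ᶠ q : Σ k, Fin (d k) in almostAll d,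
      σ q.1 g (τ q.1 q.2) = τ q.1 (σ q.1 g q.2) := hτ g
  refine ((hφ g).comp hinv).congr' ?_
  filter_upwards [hinv.eventually hcomm] with q hq
  simp only [Function.comp_apply, Prod.mk.injEq, true_and]
  simp only [Equiv.Perm.inv_def, Equiv.apply_symm_apply] at hq ⊢
  rw [hq, Equiv.symm_apply_apply]

end Microstates

/-! ### The subgroup of reachable points -/

section Reachable

variable {G X : Type*} {d : ℕ → ℕ} {σ : ∀ k, G → Equiv.Perm (Fin (d k))} [MetricSpace X]

variable (σ) in
/-- A set is charged along `F` if some sequence of microstates visits it with positive lower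
density along `F`. -/
def Charged [SMul G X] (F : Filter ℕ) (O : Set X) : Prop :=
  ∃ φ : ∀ k, Fin (d k) → X, IsTopologicalMicrostates d σ φ ∧
    ∃ c : ℝ, 0 < c ∧ ∀ᶠ k in F, c ≤ unif {j | φ k j ∈ O}

/-- The microstates are `φ` composed with the inverses of the `τ i` supplied by ergodicity: they
visit `O` on the sets `τ i '' A`. -/
theorem Charged.exists_finite_cover [CompactSpace X] [Group G] [MulAction G X] (hd : ∀ k, 0 < d k)
    (herg : HasErgodicCommutant d σ) {F : Filter ℕ} (hF : F ≤ atTop) {O : Set X}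
    (h : Charged σ F O) {ε : ℝ} (hε : 0 < ε) :
    ∃ (r : ℕ) (ψ : Fin r → ∀ k, Fin (d k) → X), (∀ i, IsTopologicalMicrostates d σ (ψ i)) ∧
      ∀ᶠ k in F, 1 - ε ≤ unif {j | ∃ i, ψ i k j ∈ O} := by
  classical
  obtain ⟨φ, hφ, c, hc, H⟩ := h
  -- Ergodicity needs a lower bound along `atTop`, while visits are controlled only along `F`; the
  -- full set fills in the other `k`.
  let A (k : ℕ) : Set (Fin (d k)) :=
    if c ≤ unif {j | φ k j ∈ O} then {j | φ k j ∈ O} else Set.univ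
  have hA (k) : min c 1 ≤ unif (A k) := by
    by_cases hk : c ≤ unif {j | φ k j ∈ O}
    · simp only [A, hk, if_true]; exact (min_le_left _ _).trans hk
    · simp only [A, hk, if_false, unif_univ (hd k)]; exact min_le_right _ _
  have hbdd {B : ∀ k, Set (Fin (d k))} :
      IsBoundedUnder (· ≥ ·) atTop (fun k => unif (B k)) :=
    isBoundedUnder_of ⟨0, fun k => unif_nonneg _⟩
  have hcobdd {B : ∀ k, Set (Fin (d k))} :
      IsCoboundedUnder (· ≥ ·) atTop (fun k => unif (B k)) :=
    (isBoundedUnder_of ⟨1, fun k => unif_le_one _⟩ :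
      IsBoundedUnder (· ≤ ·) atTop (fun k => unif (B k))).isCoboundedUnder_ge
  have hpos : 0 < liminf (fun k => unif (A k)) atTop :=
    (lt_min hc one_pos).trans_le
      (le_liminf_of_le hcobdd (Eventually.of_forall hA))
  obtain ⟨r, τ, hτ, hlim⟩ := herg A hpos (ε / 2) (half_pos hε)
  refine ⟨r, fun i k j => φ k ((τ i k)⁻¹ j), fun i => hφ.comp_commutant hd (hτ i), ?_⟩
  have hev := eventually_lt_of_lt_liminf (b := 1 - ε)
    (lt_of_lt_of_le (by linarith) hlim) hbdd
  filter_upwards [hF hev, H] with k hk hck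
  refine hk.le.trans (unif_mono ?_)
  intro j hj
  obtain ⟨i, l, hl, rfl⟩ := Set.mem_iUnion.1 hj
  simp only [A, hck, if_true] at hl
  exact ⟨i, by simpa using hl⟩

variable (σ) in
/-- The points all of whose neighbourhoods are charged along `F`. -/
def Reachable [SMul G X] (F : Filter ℕ) (x : X) : Prop := ∀ O ∈ 𝓝 x, Charged σ F O

theorem isClosed_reachable [SMul G X] (F : Filter ℕ) : IsClosed {x : X | Reachable σ F x} := by
  rw [isClosed_iff_frequently]
  intro x hx O hO
  obtain ⟨y, hy, hyO⟩ := (hx.and_eventually (eventually_mem_nhds_iff.2 hO)).exists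
  exact hy O hyO

theorem Reachable.smul [CompactSpace X] [Group G] [MulAction G X] [ContinuousConstSMul G X]
    (hd : ∀ k, 0 < d k) {F : Filter ℕ} (hF : F ≤ atTop) {x : X} (hx : Reachable σ F x) (g : G) :
    Reachable σ F (g • x) := by
  intro O hO
  obtain ⟨δ, hδ, hball⟩ := Metric.mem_nhds_iff.1 hO
  have hcont : (fun y : X => g • y) ⁻¹' Metric.ball (g • x) (δ / 2) ∈ 𝓝 x :=
    (continuous_const_smul g).continuousAt.preimage_mem_nhds
      (Metric.ball_mem_nhds _ (half_pos hδ))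
  obtain ⟨φ, hφ, c, hc, H⟩ := hx _ hcont
  refine ⟨φ, hφ, c / 2, half_pos hc, ?_⟩
  filter_upwards [H, hF ((hφ.tendsto_unif_not_dist_lt hd g
    (half_pos hδ)).eventually_lt_const (half_pos hc))] with k hk hk'
  have hsub : {j | φ k j ∈ (fun y : X => g • y) ⁻¹' Metric.ball (g • x) (δ / 2)} ⊆
      {j | σ k g j ∈ {j | φ k j ∈ O}} ∪
        {j | ¬ dist (g • φ k j) (φ k (σ k g j)) < δ / 2} := by
    intro j hj
    by_cases hjd : dist (g • φ k j) (φ k (σ k g j)) < δ / 2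
    · left
      apply hball
      have hj' : dist (g • φ k j) (g • x) < δ / 2 := hj
      rw [Metric.mem_ball]
      calc _ ≤ dist (g • φ k j) (φ k (σ k g j)) + dist (g • φ k j) (g • x) :=
            dist_triangle_left _ _ _
        _ < δ := by linarith
    · exact Or.inr hjd
  have h1 := (unif_mono hsub).trans (unif_union_le _ _)
  have h2 := unif_preimage_perm (σ k g) {j | φ k j ∈ O}
  linarith

/-- Microstates near `x` and near `y` may be so at disjoint sets of indices. Covering almost all
indices by finitely many microstates near `y` forces an overlap, and pigeonhole picks one factor for
each `k`. -/
theorem Reachable.mul [Group X] [CompactSpace X] [IsTopologicalGroup X] [Group G]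
    [MulDistribMulAction G X] (hd : ∀ k, 0 < d k) (herg : HasErgodicCommutant d σ) {F : Filter ℕ} (hF : F ≤ atTop)
    {x y : X} (hx : Reachable σ F x) (hy : Reachable σ F y) : Reachable σ F (x * y) := by
  intro O hO
  obtain ⟨U, hU, V, hV, hUV⟩ := mem_nhds_prod_iff.1
    ((continuous_mul.tendsto (x, y)) hO)
  obtain ⟨φ, hφ, c, hc, H⟩ := hx U hU
  obtain ⟨r, ψ, hψ, H'⟩ := (hy V hV).exists_finite_cover hd herg hF (half_pos hc)
  let D (i : Fin r) (k : ℕ) : Set (Fin (d k)) := {j | (φ * ψ i) k j ∈ O}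
  -- The uncovered part costs at most `c / 2`; the `+ 1` makes the sum of the `r` bounds strictly
  -- less than the remaining `c / 2`, also for `r = 0`.
  have key : ∀ᶠ k in F, ∃ i : Fin r, c / (2 * (r + 1)) ≤ unif (D i k) := by
    filter_upwards [H, H'] with k hk hk'
    by_contra! hcon
    have hsub : {j | φ k j ∈ U} ⊆ (⋃ i ∈ Finset.univ, D i k) ∪ {j | ∃ i, ψ i k j ∈ V}ᶜ := by
      intro j hj
      by_cases hjV : ∃ i, ψ i k j ∈ V
      · left
        obtain ⟨i, hi⟩ := hjV
        exact Set.mem_biUnion (Finset.mem_univ i)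
          (hUV (Set.mk_mem_prod hj hi) : φ k j * ψ i k j ∈ O)
      · exact Or.inr hjV
    have h1 := (unif_mono hsub).trans (unif_union_le _ _)
    rw [unif_compl (hd k)] at h1
    have h2 := unif_biUnion_le Finset.univ (fun i => D i k)
    have h3 : ∑ i, unif (D i k) ≤ ∑ i : Fin r, c / (2 * (r + 1)) :=
      Finset.sum_le_sum fun i _ => (hcon i).le
    have h4 : ∑ i : Fin r, c / (2 * (r + 1)) < c / 2 := by
      rw [Finset.sum_const, Finset.card_univ, Fintype.card_fin, nsmul_eq_mul, ← mul_div_assoc,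
        div_lt_div_iff₀ (by positivity) two_pos]
      linarith
    linarith
  by_cases hr : Nonempty (Fin r)
  · have (k : ℕ) : ∃ i : Fin r, (∃ i : Fin r, c / (2 * (r + 1)) ≤ unif (D i k)) →
        c / (2 * (r + 1)) ≤ unif (D i k) := by
      by_cases h : ∃ i : Fin r, c / (2 * (r + 1)) ≤ unif (D i k)
      · exact ⟨h.choose, fun _ => h.choose_spec⟩
      · exact ⟨hr.some, fun h' => absurd h' h⟩
    choose i hi using this
    exact ⟨_, IsTopologicalMicrostates.select hd (fun i => hφ.mul hd (hψ i)) i,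
      c / (2 * (r + 1)), by positivity, key.mono fun k hk => hi k hk⟩
  -- With `r = 0`, `key` is eventually false along `F`, so any claim holds eventually.
  · refine ⟨φ, hφ, 1, one_pos, key.mono fun k hk => absurd ⟨hk.choose⟩ hr⟩

variable (σ) in
/-- The reachable points form a subgroup. -/
def reachableSubgroup [Group X] [CompactSpace X] [IsTopologicalGroup X] [Group G]
    [MulDistribMulAction G X] (hd : ∀ k, 0 < d k) (herg : HasErgodicCommutant d σ) {F : Filter ℕ} (hF : F ≤ atTop) :
    Subgroup X where
  carrier := {x | Reachable σ F x}
  mul_mem' := Reachable.mul hd herg hF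
  one_mem' := by
    intro O hO
    refine ⟨1, isTopologicalMicrostates_one hd, 1, one_pos, Eventually.of_forall fun k => ?_⟩
    have : {j | (1 : ∀ k, Fin (d k) → X) k j ∈ O} = Set.univ :=
      Set.eq_univ_of_forall fun j => (mem_of_mem_nhds hO : (1 : X) ∈ O)
    rw [this, unif_univ (hd k)]
  inv_mem' := by
    intro x hx O hO
    obtain ⟨φ, hφ, c, hc, H⟩ := hx _ (continuous_inv.continuousAt.preimage_mem_nhds hO)
    exact ⟨φ⁻¹, hφ.inv hd, c, hc, H⟩

end Reachable

/-! ### Distance to a power of `Y`, computed coordinatewise -/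

section Distance

variable {X : Type*} [MetricSpace X]

theorem rho2ToPow_nonneg {d : ℕ} (φ : Fin d → X) (Y : Set X) : 0 ≤ rho2ToPow φ Y :=
  Real.iInf_nonneg fun _ => Real.sqrt_nonneg _

theorem average_infDist_sq_le_rho2ToPow_sq {d : ℕ} (φ : Fin d → X) {Y : Set X}
    (hY : Y.Nonempty) :
    (1 / (d : ℝ)) * ∑ j, Metric.infDist (φ j) Y ^ 2 ≤ rho2ToPow φ Y ^ 2 := by
  obtain ⟨y, hy⟩ := hY
  have : Nonempty {ψ : Fin d → X // ∀ j, ψ j ∈ Y} := ⟨⟨fun _ => y, fun _ => hy⟩⟩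
  refine (Real.sqrt_le_left (rho2ToPow_nonneg φ Y)).1 (le_ciInf fun ψ => ?_)
  refine Real.sqrt_le_sqrt ?_
  refine mul_le_mul_of_nonneg_left (Finset.sum_le_sum fun j _ => ?_) (by positivity)
  exact pow_le_pow_left₀ Metric.infDist_nonneg (Metric.infDist_le_dist_of_mem (ψ.2 j)) 2

theorem rho2ToPow_sq_le_average_infDist_sq {d : ℕ} (φ : Fin d → X) {Y : Set X}
    (hY : IsCompact Y) (hne : Y.Nonempty) :
    rho2ToPow φ Y ^ 2 ≤ (1 / (d : ℝ)) * ∑ j, Metric.infDist (φ j) Y ^ 2 := by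
  have (j : Fin d) : ∃ y ∈ Y, Metric.infDist (φ j) Y = dist (φ j) y :=
    hY.exists_infDist_eq_dist hne (φ j)
  choose ψ hψ hdist using this
  have h : rho2ToPow φ Y ≤ rho2 φ ψ :=
    ciInf_le (f := fun ψ : {ψ : Fin d → X // ∀ j, ψ j ∈ Y} => rho2 φ ψ.1)
      ⟨0, by rintro _ ⟨ψ, rfl⟩; exact Real.sqrt_nonneg _⟩ ⟨ψ, hψ⟩
  calc _ ≤ rho2 φ ψ ^ 2 := pow_le_pow_left₀ (rho2ToPow_nonneg φ Y) h 2
    _ = _ := by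
      rw [rho2, Real.sq_sqrt (by positivity)]
      simp only [hdist]

theorem infDist_le_diam_univ [CompactSpace X] {Y : Set X} (hY : Y.Nonempty) (x : X) :
    Metric.infDist x Y ≤ Metric.diam (Set.univ : Set X) := by
  obtain ⟨y, hy⟩ := hY
  exact (Metric.infDist_le_dist_of_mem hy).trans
    (Metric.dist_le_diam_of_mem isCompact_univ.isBounded (Set.mem_univ _) (Set.mem_univ _))

end Distance

/-! ### Subsequences through an ultrafilter -/

section Ultrafilter

variable {G X : Type*} {d : ℕ → ℕ} {σ : ∀ k, G → Equiv.Perm (Fin (d k))} [MetricSpace X]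

/-- Along an ultrafilter, failure of an eventual lower bound is an eventual upper bound; a finite
cover of `K` by uncharged sets then suffices. -/
theorem tendsto_unif_of_not_reachable [SMul G X] (ω : Ultrafilter ℕ) {K : Set X}
    (hK : IsCompact K) (hKr : ∀ x ∈ K, ¬ Reachable σ (ω : Filter ℕ) x)
    {φ : ∀ k, Fin (d k) → X} (hφ : IsTopologicalMicrostates d σ φ) {ε : ℝ} (hε : 0 < ε) :
    ∀ᶠ k in (ω : Filter ℕ), unif {j | φ k j ∈ K} < ε := by
  have h (x : X) : ∃ O ∈ 𝓝 x, x ∈ K → ¬ Charged σ (ω : Filter ℕ) O := by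
    by_cases hx : x ∈ K
    · have := hKr x hx
      unfold Reachable at this
      push Not at this
      obtain ⟨O, hO, hch⟩ := this
      exact ⟨O, hO, fun _ => hch⟩
    · exact ⟨Set.univ, univ_mem, fun h => absurd h hx⟩
  choose O hO hch using h
  obtain ⟨t, htK, ht⟩ := hK.elim_nhds_subcover O fun x _ => hO x
  have hsmall : ∀ x ∈ t, ∀ᶠ k in (ω : Filter ℕ),
      unif {j | φ k j ∈ O x} < ε / (t.card + 1) := by
    intro x hx
    simp only [← not_le]
    rw [Ultrafilter.eventually_not]
    exact fun H => hch x (htK x hx) ⟨φ, hφ, _, by positivity, H⟩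
  filter_upwards [(eventually_all_finset t).2 hsmall] with k hk
  have hsub : {j | φ k j ∈ K} ⊆ ⋃ x ∈ t, {j | φ k j ∈ O x} := by
    intro j hj
    simpa using ht hj
  calc _ ≤ ∑ x ∈ t, unif {j | φ k j ∈ O x} := (unif_mono hsub).trans (unif_biUnion_le _ _)
    _ ≤ ∑ x ∈ t, ε / (t.card + 1) := Finset.sum_le_sum fun x hx => (hk x hx).le
    _ < ε := by
      rw [Finset.sum_const, nsmul_eq_mul, ← mul_div_assoc, div_lt_iff₀ (by positivity)]
      linarith

theorem eventually_rho2ToPow_lt [CompactSpace X] [SMul G X] (hd : ∀ k, 0 < d k)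
    (ω : Ultrafilter ℕ) {Y : Set X} (hYc : IsClosed Y) (hYne : Y.Nonempty) (hY : ∀ x, Reachable σ (ω : Filter ℕ) x → x ∈ Y)
    {φ : ∀ k, Fin (d k) → X} (hφ : IsTopologicalMicrostates d σ φ) {ε : ℝ} (hε : 0 < ε) :
    ∀ᶠ k in (ω : Filter ℕ), rho2ToPow (φ k) Y < ε := by
  set D := Metric.diam (Set.univ : Set X) ^ 2
  have hD0 : 0 ≤ D := sq_nonneg _
  -- Indices with values outside `K` contribute at most `ε ^ 2 / 2` to the average; those in `K` are
  -- rare, since `K` is compact and has no reachable point.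
  let K : Set X := {x | ε ^ 2 / 2 ≤ Metric.infDist x Y ^ 2}
  have hK : IsCompact K := (isClosed_le continuous_const
    ((Metric.continuous_infDist_pt Y).pow 2)).isCompact
  have hKr : ∀ x ∈ K, ¬ Reachable σ (ω : Filter ℕ) x := by
    intro x hx hr
    have h0 := Metric.infDist_zero_of_mem (hY x hr)
    have : ε ^ 2 / 2 ≤ Metric.infDist x Y ^ 2 := hx
    rw [h0] at this
    have : 0 < ε ^ 2 := by positivity
    linarith
  have hpos : 0 < ε ^ 2 / (2 * (D + 1)) := by positivity
  filter_upwards [tendsto_unif_of_not_reachable ω hK hKr hφ hpos] with k hk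
  have h1 := rho2ToPow_sq_le_average_infDist_sq (φ k) hYc.isCompact hYne
  have h2 := average_le_add_mul_unif (hd k) (fun j => Metric.infDist (φ k j) Y ^ 2)
    (a := ε ^ 2 / 2) (D := D) (by positivity)
    (fun j => pow_le_pow_left₀ Metric.infDist_nonneg (infDist_le_diam_univ hYne _) 2)
  have h3 : D * unif {j | φ k j ∈ K} < ε ^ 2 / 2 := by
    have : D * unif {j | φ k j ∈ K} ≤ D * (ε ^ 2 / (2 * (D + 1))) := by gcongr
    refine this.trans_lt ?_
    rw [← mul_div_assoc, div_lt_div_iff₀ (by positivity) two_pos]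
    nlinarith [sq_pos_of_pos hε]
  have h4 : rho2ToPow (φ k) Y ^ 2 < ε ^ 2 := by
    refine h1.trans_lt (h2.trans_lt ?_)
    have : D * unif {j | ε ^ 2 / 2 ≤ Metric.infDist (φ k j) Y ^ 2} < ε ^ 2 / 2 := h3
    linarith
  exact lt_of_pow_lt_pow_left₀ 2 hε.le h4

theorem exists_subseq_rho2ToPow_tendsto [CompactSpace X] [SMul G X] (hd : ∀ k, 0 < d k)
    {ω : Ultrafilter ℕ} (hω : (ω : Filter ℕ) ≤ atTop) {Y : Set X} (hYc : IsClosed Y) (hYne : Y.Nonempty) (hY : ∀ x, Reachable σ (ω : Filter ℕ) x → x ∈ Y)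
    {φ : ∀ k, Fin (d k) → X} (hφ : IsTopologicalMicrostates d σ φ) :
    ∃ κ : ℕ → ℕ, StrictMono κ ∧ Tendsto (fun l => rho2ToPow (φ (κ l)) Y) atTop (𝓝 0) := by
  obtain ⟨κ, hκ, h⟩ := extraction_forall_of_frequently
    (P := fun n k => rho2ToPow (φ k) Y < 1 / ((n : ℝ) + 1)) fun n =>
      ((eventually_rho2ToPow_lt hd ω hYc hYne hY hφ (by positivity)).frequently.filter_mono hω)
  exact ⟨κ, hκ, squeeze_zero (fun l => rho2ToPow_nonneg _ _) (fun l => (h l).le)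
    tendsto_one_div_add_atTop_nhds_zero_nat⟩

/-- A set that is not charged along `atTop` is asymptotically not visited at all along a single
ultrafilter. -/
theorem exists_ultrafilter_not_charged [CompactSpace X] [SMul G X] (hd : ∀ k, 0 < d k) {O : Set X}
    (hO : ¬ Charged σ atTop O) :
    ∃ ω : Ultrafilter ℕ, (ω : Filter ℕ) ≤ atTop ∧ ¬ Charged σ (ω : Filter ℕ) O := by
  by_cases hne : ∃ φ : ∀ k, Fin (d k) → X, IsTopologicalMicrostates d σ φ
  swap
  · obtain ⟨ω, hω⟩ := Ultrafilter.exists_le (atTop : Filter ℕ)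
    exact ⟨ω, hω, fun ⟨φ, hφ, _⟩ => hne ⟨φ, hφ⟩⟩
  obtain ⟨φ₀, hφ₀⟩ := hne
  let J := {φ : ∀ k, Fin (d k) → X // IsTopologicalMicrostates d σ φ} × {c : ℝ // 0 < c} × ℕ
  have : Nonempty J := ⟨⟨φ₀, hφ₀⟩, ⟨1, one_pos⟩, 0⟩
  let S (p : J) : Set ℕ := {k | unif {j | p.1.1 k j ∈ O} < p.2.1.1 ∧ p.2.2 ≤ k}
  have hdir : Directed (· ≥ ·) fun p => 𝓟 (S p) := by
    rintro ⟨⟨φ, hφ⟩, ⟨c, hc⟩, N⟩ ⟨⟨ψ, hψ⟩, ⟨c', hc'⟩, N'⟩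
    -- For each `k`, keep whichever microstate visits `O` more often; the result dominates both,
    -- which makes the sets `S` directed.
    let i (k : ℕ) : Bool := decide (unif {j | φ k j ∈ O} ≤ unif {j | ψ k j ∈ O})
    let χ : ∀ k, Fin (d k) → X := fun k => (if i k then ψ else φ) k
    have hχ : IsTopologicalMicrostates d σ χ :=
      IsTopologicalMicrostates.select hd (φ := fun b : Bool => if b then ψ else φ)
        (by intro b; cases b <;> simpa) i
    have hχφ (k) : unif {j | φ k j ∈ O} ≤ unif {j | χ k j ∈ O} := by
      by_cases h : unif {j | φ k j ∈ O} ≤ unif {j | ψ k j ∈ O} <;> simp [χ, i, h]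
    have hχψ (k) : unif {j | ψ k j ∈ O} ≤ unif {j | χ k j ∈ O} := by
      by_cases h : unif {j | φ k j ∈ O} ≤ unif {j | ψ k j ∈ O}
      · simp [χ, i, h]
      · simpa [χ, i, h] using (not_le.1 h).le
    refine ⟨⟨⟨χ, hχ⟩, ⟨min c c', lt_min hc hc'⟩, max N N'⟩, ?_, ?_⟩
    · exact principal_mono.2 fun k hk =>
        ⟨(hχφ k).trans_lt (hk.1.trans_le (min_le_left _ _)), (le_max_left _ _).trans hk.2⟩
    · exact principal_mono.2 fun k hk =>
        ⟨(hχψ k).trans_lt (hk.1.trans_le (min_le_right _ _)), (le_max_right _ _).trans hk.2⟩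
  have hbot : (⨅ p, 𝓟 (S p)).NeBot := by
    refine iInf_neBot_of_directed' hdir fun p => ?_
    rw [principal_neBot_iff]
    by_contra hemp
    refine hO ⟨p.1.1, p.1.2, p.2.1.1, p.2.1.2, ?_⟩
    filter_upwards [eventually_ge_atTop p.2.2] with k hk
    by_contra hlt
    exact hemp ⟨k, not_le.1 hlt, hk⟩
  obtain ⟨ω, hω⟩ := Ultrafilter.exists_le (⨅ p, 𝓟 (S p))
  have hmem (p : J) : ∀ᶠ k in (ω : Filter ℕ), k ∈ S p :=
    hω (mem_iInf_of_mem p (mem_principal_self _))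
  refine ⟨ω, ?_, ?_⟩
  · intro s hs
    obtain ⟨N, hN⟩ := mem_atTop_sets.1 hs
    exact (hmem ⟨⟨φ₀, hφ₀⟩, ⟨1, one_pos⟩, N⟩).mono fun k hk => hN k hk.2
  · rintro ⟨φ, hφ, c, hc, H⟩
    obtain ⟨k, hk, hk'⟩ := (H.and (hmem ⟨⟨φ, hφ⟩, ⟨c, hc⟩, 0⟩)).exists
    exact hk.not_gt hk'.1

theorem exists_subgroup_of_not_reachable [CompactSpace X] [Group X] [IsTopologicalGroup X]
    [Group G] [MulDistribMulAction G X] [ContinuousConstSMul G X] (hd : ∀ k, 0 < d k)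
    (herg : HasErgodicCommutant d σ) {x : X} (hx : ¬ Reachable σ atTop x) :
    ∃ Y : Subgroup X, Y ≠ ⊤ ∧ IsClosed (Y : Set X) ∧ (∀ g : G, ∀ y ∈ Y, g • y ∈ Y) ∧
      ∀ φ : ∀ k, Fin (d k) → X, IsTopologicalMicrostates d σ φ →
        ∃ κ : ℕ → ℕ, StrictMono κ ∧
          Tendsto (fun l => rho2ToPow (φ (κ l)) (Y : Set X)) atTop (𝓝 0) := by
  unfold Reachable at hx
  push Not at hx
  obtain ⟨O, hO, hch⟩ := hx
  obtain ⟨ω, hω, hωO⟩ := exists_ultrafilter_not_charged hd hch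
  refine ⟨reachableSubgroup σ hd herg hω, ?_, isClosed_reachable _,
    fun g y hy => Reachable.smul hd hω hy g, fun φ hφ =>
      exists_subseq_rho2ToPow_tendsto hd hω (isClosed_reachable _) ⟨1, one_mem (reachableSubgroup σ hd herg hω)⟩
        (fun x h => h) hφ⟩
  intro htop
  have : x ∈ reachableSubgroup σ hd herg hω := htop ▸ Subgroup.mem_top x
  exact hωO (this O hO)

end Ultrafilter

/-! ### Contraction of averages towards the Haar integral -/

section Convolution

variable {X : Type*} [Group X]

/-- Averaging a function over left translates by the finite family `a`. -/
noncomputable def translateAverage {ι : Type*} [Fintype ι] (a : ι → X) (h : X → ℝ) (x : X) : ℝ :=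
  (1 / (Fintype.card ι : ℝ)) * ∑ i, h (a i * x)

/-- A Doeblin argument: take `l` minimizing `h (a l * y)` and `i` with `a i * x` in `a l * y * V`.
The `i`-th difference is at most `η`, each other one at most `s`. -/
theorem translateAverage_sub_le {ι : Type*} [Fintype ι] [Nonempty ι] {a : ι → X} {V : Set X}
    (ha : ∀ x y, ∃ i, x * a i * y ∈ V) {h : X → ℝ} {η s : ℝ}
    (hV : ∀ b, ∀ v ∈ V, |h (b * v) - h b| ≤ η) (hs : ∀ x y, h x - h y ≤ s) (x y : X) :
    translateAverage a h x - translateAverage a h y ≤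
      (1 - 1 / (Fintype.card ι : ℝ)) * s + 1 / (Fintype.card ι : ℝ) * η := by
  classical
  obtain ⟨l, -, hl⟩ := Finset.exists_min_image Finset.univ (fun i => h (a i * y))
    Finset.univ_nonempty
  obtain ⟨i, hi⟩ := ha (a l * y)⁻¹ x
  have hi' : h (a i * x) - h (a i * y) ≤ η := by
    have h1 := le_of_abs_le (hV (a l * y) _ hi)
    have h2 := hl i (Finset.mem_univ i)
    have h3 : a l * y * ((a l * y)⁻¹ * a i * x) = a i * x := by group
    rw [h3] at h1
    linarith
  have hsum : ∑ j, (h (a j * x) - h (a j * y)) ≤ ((Fintype.card ι : ℝ) - 1) * s + η := by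
    rw [← Finset.sum_erase_add _ _ (Finset.mem_univ i)]
    refine add_le_add ?_ hi'
    calc _ ≤ ∑ _j ∈ Finset.univ.erase i, s := Finset.sum_le_sum fun j _ => hs _ _
      _ = _ := by
        rw [Finset.sum_const, Finset.card_erase_of_mem (Finset.mem_univ i), nsmul_eq_mul,
          Finset.card_univ, Nat.cast_pred Fintype.card_pos]
  have hm : (Fintype.card ι : ℝ) ≠ 0 := by simp
  rw [translateAverage, translateAverage, ← mul_sub, ← Finset.sum_sub_distrib]
  calc _ ≤ 1 / (Fintype.card ι : ℝ) * (((Fintype.card ι : ℝ) - 1) * s + η) := by gcongr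
    _ = _ := by field_simp

theorem abs_translateAverage_mul_sub_le {ι : Type*} [Fintype ι] [Nonempty ι] (a : ι → X)
    {V : Set X} {h : X → ℝ} {η : ℝ} (hV : ∀ b, ∀ v ∈ V, |h (b * v) - h b| ≤ η) :
    ∀ b, ∀ v ∈ V, |translateAverage a h (b * v) - translateAverage a h b| ≤ η := by
  intro b v hv
  have hm : (Fintype.card ι : ℝ) ≠ 0 := by simp
  rw [translateAverage, translateAverage, ← mul_sub, ← Finset.sum_sub_distrib, abs_mul,
    abs_of_nonneg (by positivity)]
  calc _ ≤ 1 / (Fintype.card ι : ℝ) * ∑ _i : ι, η := by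
        gcongr
        refine (Finset.abs_sum_le_sum_abs _ _).trans (Finset.sum_le_sum fun i _ => ?_)
        rw [← mul_assoc]
        exact hV _ _ hv
    _ = η := by
        rw [Finset.sum_const, Finset.card_univ, nsmul_eq_mul]
        field_simp

/-- Averaging left translates preserves the modulus `η` for right translation, so the one-step bound
iterates; its affine recursion in `s` has fixed point `η`. -/
theorem translateAverage_iterate_sub_le {ι : Type*} [Fintype ι] [Nonempty ι] {a : ι → X}
    {V : Set X} (ha : ∀ x y, ∃ i, x * a i * y ∈ V) {h : X → ℝ} {η s : ℝ} (hη : 0 ≤ η)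
    (hV : ∀ b, ∀ v ∈ V, |h (b * v) - h b| ≤ η) (hs : ∀ x y, h x - h y ≤ s) (n : ℕ) :
    ∀ x y, (translateAverage a)^[n] h x - (translateAverage a)^[n] h y ≤
      (1 - 1 / (Fintype.card ι : ℝ)) ^ n * s + η := by
  have hV' (n : ℕ) : ∀ b, ∀ v ∈ V,
      |(translateAverage a)^[n] h (b * v) - (translateAverage a)^[n] h b| ≤ η := by
    induction n with
    | zero => exact hV
    | succ n ih =>
      rw [Function.iterate_succ_apply']
      exact abs_translateAverage_mul_sub_le a ih
  induction n with
  | zero => intro x y; simpa using (hs x y).trans (le_add_of_nonneg_right hη)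
  | succ n ih =>
    intro x y
    rw [Function.iterate_succ_apply']
    refine (translateAverage_sub_le ha (hV' n) ih x y).trans_eq ?_
    ring

variable [TopologicalSpace X] [IsTopologicalGroup X]

theorem continuous_translateAverage {ι : Type*} [Fintype ι] (a : ι → X) {h : X → ℝ}
    (hh : Continuous h) : Continuous (translateAverage a h) := by
  unfold translateAverage
  fun_prop

variable [CompactSpace X]

theorem exists_nhds_one_abs_sub_le {h : X → ℝ} (hh : Continuous h) {η : ℝ} (hη : 0 < η) :
    ∃ V ∈ 𝓝 (1 : X), ∀ b, ∀ v ∈ V, |h (b * v) - h b| ≤ η := by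
  have hcont : Continuous fun p : X × X => |h (p.2 * p.1) - h p.2| := by fun_prop
  have hev := isCompact_univ.eventually_forall_of_forall_eventually (x₀ := (1 : X))
    (P := fun v b => |h (b * v) - h b| < η) (K := Set.univ) fun b _ =>
      hcont.continuousAt.eventually_lt continuousAt_const (by simpa using hη)
  exact ⟨_, hev, fun b v hv => (hv b (Set.mem_univ b)).le⟩

/-- Near `(x, y)`, any `a` close to `x⁻¹ * y⁻¹` works, by continuity; compactness of `X × X` makes
finitely many targets suffice. -/
theorem exists_finset_nhds_mul_mem {V : Set X} (hV : V ∈ 𝓝 (1 : X)) :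
    ∃ (t : Finset (X × X)) (O : X × X → Set X), (∀ p, ∃ z, O p ∈ 𝓝 z) ∧
      ∀ x y, ∃ p ∈ t, ∀ a ∈ O p, x * a * y ∈ V := by
  have h (p : X × X) : ∃ N ∈ 𝓝 p, ∃ O ∈ 𝓝 (p.1⁻¹ * p.2⁻¹),
      ∀ q ∈ N, ∀ a ∈ O, q.1 * a * q.2 ∈ V := by
    have hcont : Continuous fun q : (X × X) × X => q.1.1 * q.2 * q.1.2 := by fun_prop
    have hmem : (fun q : (X × X) × X => q.1.1 * q.2 * q.1.2) ⁻¹' V ∈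
        𝓝 (p, p.1⁻¹ * p.2⁻¹) := by
      refine hcont.continuousAt.preimage_mem_nhds ?_
      simpa using hV
    obtain ⟨N, hN, O, hO, hNO⟩ := mem_nhds_prod_iff.1 hmem
    exact ⟨N, hN, O, hO, fun q hq a ha => hNO (Set.mk_mem_prod hq ha)⟩
  choose N hN O hO hNO using h
  obtain ⟨t, -, ht⟩ := isCompact_univ.elim_nhds_subcover N fun p _ => hN p
  refine ⟨t, O, fun p => ⟨_, hO p⟩, fun x y => ?_⟩
  obtain ⟨p, hp, hxy⟩ := Set.mem_iUnion₂.1 (ht (Set.mem_univ (x, y)))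
  exact ⟨p, hp, hNO p (x, y) hxy⟩

variable [MeasurableSpace X] [BorelSpace X]

theorem integrable_haarProb {h : X → ℝ} (hh : Continuous h) :
    Integrable h (haarProb X : Measure X) :=
  (BoundedContinuousFunction.mkOfCompact ⟨h, hh⟩).integrable _

theorem integral_translateAverage {ι : Type*} [Fintype ι] [Nonempty ι] (a : ι → X) {h : X → ℝ}
    (hh : Continuous h) :
    ∫ x, translateAverage a h x ∂(haarProb X : Measure X) = ∫ x, h x ∂(haarProb X : Measure X) := by
  have : (haarProb X : Measure X).IsMulLeftInvariant :=
    inferInstanceAs (Measure.haarMeasure _).IsMulLeftInvariant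
  have hm : (Fintype.card ι : ℝ) ≠ 0 := by simp
  unfold translateAverage
  rw [integral_const_mul, integral_finsetSum _ fun i _ => integrable_haarProb (by fun_prop)]
  simp only [integral_mul_left_eq_self]
  rw [Finset.sum_const, Finset.card_univ, nsmul_eq_mul]
  field_simp

theorem abs_translateAverage_iterate_sub_integral_le {ι : Type*} [Fintype ι] [Nonempty ι]
    {a : ι → X} {V : Set X} (ha : ∀ x y, ∃ i, x * a i * y ∈ V) {h : X → ℝ} (hh : Continuous h)
    {η s : ℝ} (hη : 0 ≤ η) (hV : ∀ b, ∀ v ∈ V, |h (b * v) - h b| ≤ η)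
    (hs : ∀ x y, h x - h y ≤ s) (n : ℕ) (x : X) :
    |(translateAverage a)^[n] h x - ∫ y, h y ∂(haarProb X : Measure X)| ≤
      (1 - 1 / (Fintype.card ι : ℝ)) ^ n * s + η := by
  have hc (n : ℕ) : Continuous ((translateAverage a)^[n] h) ∧
      ∫ y, (translateAverage a)^[n] h y ∂(haarProb X : Measure X) =
        ∫ y, h y ∂(haarProb X : Measure X) := by
    induction n with
    | zero => exact ⟨hh, rfl⟩
    | succ n ih =>
      simp only [Function.iterate_succ_apply']
      exact ⟨continuous_translateAverage a ih.1,
        (integral_translateAverage a ih.1).trans ih.2⟩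
  rw [← (hc n).2]
  have hosc := translateAverage_iterate_sub_le ha hη hV hs n
  have hconst (c : ℝ) : ∫ _y, c ∂(haarProb X : Measure X) = c := by simp
  rw [abs_sub_le_iff]
  constructor
  · have : ∫ _y, (translateAverage a)^[n] h x - ((1 - 1 / (Fintype.card ι : ℝ)) ^ n * s + η)
        ∂(haarProb X : Measure X) ≤ ∫ y, (translateAverage a)^[n] h y ∂(haarProb X : Measure X) :=
      integral_mono (integrable_const _) (integrable_haarProb (hc n).1) fun y => by
        have := hosc x y
        simp only
        linarith
    rw [hconst] at this
    linarith
  · have : ∫ y, (translateAverage a)^[n] h y ∂(haarProb X : Measure X) ≤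
        ∫ _y, (translateAverage a)^[n] h x + ((1 - 1 / (Fintype.card ι : ℝ)) ^ n * s + η)
          ∂(haarProb X : Measure X) :=
      integral_mono (integrable_haarProb (hc n).1) (integrable_const _) fun y => by
        have := hosc y x
        simp only
        linarith
    rw [hconst] at this
    linarith

end Convolution

-- Weak* neighbourhoods and uniform laws of finite families

universe u

theorem exists_integral_nhds {X : Type*} [TopologicalSpace X] [MeasurableSpace X]
    [OpensMeasurableSpace X] {ν : ProbabilityMeasure X} {O : Set (ProbabilityMeasure X)}
    (hO : O ∈ 𝓝 ν) :
    ∃ T : Set (BoundedContinuousFunction X ℝ), T.Finite ∧ ∃ η : ℝ, 0 < η ∧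
      ∀ μ : ProbabilityMeasure X,
        (∀ f ∈ T, |∫ x, f x ∂(μ : Measure X) - ∫ x, f x ∂(ν : Measure X)| ≤ η) → μ ∈ O := by
  let l (f : BoundedContinuousFunction X ℝ) : Filter (ProbabilityMeasure X) :=
    comap (fun μ => ∫ x, f x ∂(μ : Measure X)) (𝓝 (∫ x, f x ∂(ν : Measure X)))
  have hl : Tendsto id (⨅ f, l f) (𝓝 ν) :=
    ProbabilityMeasure.tendsto_iff_forall_integral_tendsto.2 fun f =>
      tendsto_comap.mono_left (iInf_le l f)
  have hb (f) : (l f).HasBasis (fun r : ℝ => 0 < r) _ :=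
    (Metric.nhds_basis_ball (x := ∫ x, f x ∂(ν : Measure X))).comap _
  obtain ⟨⟨T, r⟩, ⟨hT, hr⟩, hsub⟩ := (HasBasis.iInf' hb).mem_iff.1 (hl hO)
  have hη : ∀ᶠ η : ℝ in 𝓝[>] 0, ∀ f ∈ T, η < r f :=
    (eventually_all_finite hT).2 fun f hf =>
      (eventually_lt_nhds (hr f hf)).filter_mono nhdsWithin_le_nhds
  obtain ⟨η, hη, hη0⟩ := (hη.and self_mem_nhdsWithin).exists
  refine ⟨T, hT, η, hη0, fun μ hμ => hsub ?_⟩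
  simp only [Set.mem_iInter]
  intro f hf
  exact (hμ f hf).trans_lt (hη f hf)

section FamilyMeasure

variable {X : Type*} [MeasurableSpace X]

/-- The law of a uniformly chosen member of a finite family of points. -/
noncomputable def familyMeasure {I : Type*} [Fintype I] [Nonempty I] (φ : I → X) :
    ProbabilityMeasure X :=
  letI : MeasurableSpace I := ⊤
  ⟨(PMF.uniformOfFintype I).toMeasure.map φ,
    Measure.isProbabilityMeasure_map measurable_from_top.aemeasurable⟩

theorem familyMeasure_eq_one {I : Type*} [Fintype I] [Nonempty I] {φ : I → X} {S : Set X}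
    (h : ∀ i, φ i ∈ S) : familyMeasure φ S = 1 := by
  let : MeasurableSpace I := ⊤
  refine le_antisymm (ProbabilityMeasure.apply_le_one _ _) ?_
  rw [← ENNReal.coe_le_coe, ProbabilityMeasure.ennreal_coeFn_eq_coeFn_toMeasure, ENNReal.coe_one]
  calc (1 : ENNReal) = (PMF.uniformOfFintype I).toMeasure (φ ⁻¹' S) := by
        rw [Set.preimage_eq_univ_iff.2 (Set.range_subset_iff.2 h), measure_univ]
    _ ≤ _ := Measure.le_map_apply measurable_from_top.aemeasurable S

theorem integral_marginal_familyMeasure [TopologicalSpace X] [BorelSpace X] {d : ℕ} {I : Type*}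
    [Fintype I] [Nonempty I] (φ : I → Fin d → X) (j : Fin d) {f : X → ℝ} (hf : Continuous f) :
    ∫ x, f x ∂(marginal (familyMeasure φ) j : Measure X) =
      (1 / (Fintype.card I : ℝ)) * ∑ i, f (φ i j) := by
  let : MeasurableSpace I := ⊤
  have h : (marginal (familyMeasure φ) j : Measure X) =
      ((PMF.uniformOfFintype I).toMeasure.map φ).map fun x => x j := rfl
  rw [h, Measure.map_map (measurable_pi_apply j) measurable_from_top,
    integral_map measurable_from_top.aemeasurable hf.measurable.aestronglyMeasurable,
    PMF.integral_eq_sum, Finset.mul_sum]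
  simp

end FamilyMeasure

/-! ### Families of microstates with nearly Haar marginals -/

variable {G : Type*} {d : ℕ → ℕ} {σ : ∀ k, G → Equiv.Perm (Fin (d k))}

theorem exists_family_average_eq_iterate {X : Type*} [Group X] [MetricSpace X] [CompactSpace X]
    [IsTopologicalGroup X] [Group G] [MulDistribMulAction G X] (hd : ∀ k, 0 < d k)
    {ι : Type u} [Fintype ι] [Nonempty ι] {a : ι → ∀ k, Fin (d k) → X}
    (ha : ∀ i, IsTopologicalMicrostates d σ (a i)) (n : ℕ) :
    ∃ (I : Type u) (_ : Fintype I) (_ : Nonempty I) (φ : I → ∀ k, Fin (d k) → X),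
      (∀ i, IsTopologicalMicrostates d σ (φ i)) ∧
      ∀ (h : X → ℝ) (k : ℕ) (j : Fin (d k)) (x : X),
        (1 / (Fintype.card I : ℝ)) * ∑ i, h (φ i k j * x) =
          (translateAverage fun i => a i k j)^[n] h x := by
  induction n with
  | zero =>
    exact ⟨PUnit, inferInstance, inferInstance, fun _ => 1,
      fun _ => isTopologicalMicrostates_one hd, by simp⟩
  | succ n ih =>
    obtain ⟨I, _, _, φ, hφ, hav⟩ := ih
    -- The new factor goes on the right because the outermost average evaluates the earlier iterate
    -- at `a i * x`.
    refine ⟨ι × I, inferInstance, inferInstance, fun p => φ p.2 * a p.1,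
      fun p => (hφ p.2).mul hd (ha p.1), fun h k j x => ?_⟩
    rw [Function.iterate_succ_apply', translateAverage, Fintype.sum_prod_type,
      Fintype.card_prod, Nat.cast_mul]
    simp only [← hav, ← Finset.mul_sum, Pi.mul_apply, mul_assoc]
    rw [← mul_assoc (1 / (Fintype.card ι : ℝ)), one_div_mul_one_div]

theorem exists_family_dense {X : Type u} [Group X] [MetricSpace X] [CompactSpace X]
    [IsTopologicalGroup X] [Group G] [MulDistribMulAction G X] (hd : ∀ k, 0 < d k)
    (herg : HasErgodicCommutant d σ) (hR : ∀ x : X, Reachable σ atTop x) {V : Set X}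
    (hV : V ∈ 𝓝 1) {ε : ℝ} (hε : 0 < ε) :
    ∃ (ι : Type u) (_ : Fintype ι) (_ : Nonempty ι) (a : ι → ∀ k, Fin (d k) → X),
      (∀ i, IsTopologicalMicrostates d σ (a i)) ∧
      ∀ᶠ k in atTop, 1 - ε ≤ unif {j | ∀ x y, ∃ i, x * a i k j * y ∈ V} := by
  obtain ⟨t, O, hO, ht⟩ := exists_finset_nhds_mul_mem hV
  have hc (p : X × X) : Charged σ atTop (O p) := by
    obtain ⟨z, hz⟩ := hO p
    exact hR z _ hz
  have hε' : 0 < ε / (t.card + 1) := by positivity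
  choose r ψ hψ H using fun p => (hc p).exists_finite_cover hd herg le_rfl hε'
  -- The extra member `1` keeps the family nonempty.
  refine ⟨Option (Σ p : t, Fin (r p)), inferInstance, inferInstance,
    fun o => o.elim 1 fun q => ψ q.1 q.2, ?_, ?_⟩
  · rintro (_ | q)
    · exact isTopologicalMicrostates_one hd
    · exact hψ _ _
  filter_upwards [(eventually_all_finset t).2 fun p _ => H p] with k hk
  set S : Set (Fin (d k)) :=
    {j | ∀ x y : X, ∃ i : Option (Σ p : t, Fin (r p)),
      x * (i.elim (1 : ∀ k, Fin (d k) → X) fun q => ψ q.1 q.2) k j * y ∈ V}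
  have hsub : Sᶜ ⊆ ⋃ p ∈ t, {j | ∃ i, ψ p i k j ∈ O p}ᶜ := by
    intro j hj
    by_contra hcon
    refine hj fun x y => ?_
    obtain ⟨p, hp, hpV⟩ := ht x y
    have : ∃ i, ψ p i k j ∈ O p := by
      by_contra hno
      exact hcon (Set.mem_biUnion hp hno)
    obtain ⟨i, hi⟩ := this
    exact ⟨some ⟨⟨p, hp⟩, i⟩, hpV _ hi⟩
  have h1 := (unif_mono hsub).trans (unif_biUnion_le _ _)
  have h2 : ∑ p ∈ t, unif {j | ∃ i, ψ p i k j ∈ O p}ᶜ ≤ ∑ p ∈ t, ε / (t.card + 1) := by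
    refine Finset.sum_le_sum fun p hp => ?_
    rw [unif_compl (hd k)]
    linarith [hk p hp]
  have h3 : ∑ p ∈ t, ε / (t.card + 1) ≤ ε := by
    rw [Finset.sum_const, nsmul_eq_mul, ← mul_div_assoc, div_le_iff₀ (by positivity)]
    linarith
  rw [unif_compl (hd k)] at h1
  linarith

theorem exists_family_marginal_mem {X : Type u} [Group X] [MetricSpace X] [CompactSpace X]
    [IsTopologicalGroup X] [MeasurableSpace X] [BorelSpace X] [Group G] [MulDistribMulAction G X]
    (hd : ∀ k, 0 < d k) (herg : HasErgodicCommutant d σ) (hR : ∀ x : X, Reachable σ atTop x)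
    {O : Set (ProbabilityMeasure X)} (hO : O ∈ 𝓝 (haarProb X)) {ε : ℝ} (hε : 0 < ε) :
    ∃ (I : Type u) (_ : Fintype I) (_ : Nonempty I) (φ : I → ∀ k, Fin (d k) → X),
      (∀ i, IsTopologicalMicrostates d σ (φ i)) ∧
      ∀ᶠ k in atTop, 1 - ε ≤ unif {j | marginal (familyMeasure fun i => φ i k) j ∈ O} := by
  obtain ⟨T, hT, η, hη, hTO⟩ := exists_integral_nhds hO
  have hη2 : 0 < η / 2 := half_pos hη
  choose W hW hWη using fun f : BoundedContinuousFunction X ℝ =>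
    exists_nhds_one_abs_sub_le f.continuous hη2
  obtain ⟨ι, _, _, a, ha, hdense⟩ := exists_family_dense hd herg hR
    ((biInter_mem hT).2 fun f _ => hW f) hε
  have hm : (1 : ℝ) ≤ Fintype.card ι := by exact_mod_cast Fintype.card_pos (α := ι)
  have hpow : Tendsto (fun n : ℕ => (1 - 1 / (Fintype.card ι : ℝ)) ^ n) atTop (𝓝 0) := by
    refine tendsto_pow_atTop_nhds_zero_of_lt_one ?_ ?_
    · rw [sub_nonneg, div_le_one (by linarith)]
      exact hm
    · have : 0 < 1 / (Fintype.card ι : ℝ) := by positivity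
      linarith
  have hsmall : ∀ᶠ n : ℕ in atTop, ∀ f ∈ T,
      (1 - 1 / (Fintype.card ι : ℝ)) ^ n * (2 * ‖f‖) < η / 2 := by
    refine (eventually_all_finite hT).2 fun f _ => ?_
    have := hpow.mul_const (2 * ‖f‖)
    rw [zero_mul] at this
    exact this.eventually_lt_const hη2
  -- The walk length depends only on `T`, `η` and the family size, not on `k` or `j`, so one finite
  -- family serves all large `k`.
  obtain ⟨n, hn⟩ := hsmall.exists
  obtain ⟨I, _, _, φ, hφ, hav⟩ := exists_family_average_eq_iterate hd ha n
  refine ⟨I, inferInstance, inferInstance, φ, hφ, hdense.mono fun k hk => hk.trans ?_⟩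
  refine unif_mono fun j hj => hTO _ fun f hf => ?_
  rw [integral_marginal_familyMeasure _ _ f.continuous]
  have h1 := hav f k j 1
  simp only [mul_one] at h1
  rw [h1]
  have hs : ∀ x y, f x - f y ≤ 2 * ‖f‖ := fun x y =>
    (le_abs_self _).trans (f.dist_le_two_norm x y)
  have hdj : ∀ x y, ∃ i, x * a i k j * y ∈ W f := fun x y => by
    obtain ⟨i, hi⟩ := hj x y
    exact ⟨i, Set.mem_iInter₂.1 hi f hf⟩
  have := abs_translateAverage_iterate_sub_integral_le hdj f.continuous hη2.le (hWη f) hs n 1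
  linarith [hn f hf]

/-! ### Microstates by countably many metric conditions -/

section

variable {G X : Type*} {d : ℕ → ℕ} {σ : ∀ k, G → Equiv.Perm (Fin (d k))} [MetricSpace X]

theorem exists_nat_dist_lt_subset [CompactSpace X] {U : Set (X × X)}
    (hU : U ∈ 𝓝ˢ (Set.diagonal X)) {ε : ℝ} (hε : 0 < ε) :
    ∃ n : ℕ, 1 / ((n : ℝ) + 1) < ε ∧ ∀ x y : X, dist x y < 1 / ((n : ℝ) + 1) → (x, y) ∈ U := by
  rw [nhdsSet_diagonal_eq_uniformity] at hU
  obtain ⟨δ, hδ, hsub⟩ := Metric.mem_uniformity_dist.1 hU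
  obtain ⟨n, hn⟩ := exists_nat_one_div_lt (lt_min hδ hε)
  exact ⟨n, hn.trans_le (min_le_right _ _),
    fun x y h => hsub (h.trans (hn.trans_le (min_le_left _ _)))⟩

theorem isTopologicalMicrostates_of_eventually_le [CompactSpace X] [SMul G X]
    {φ : ∀ k, Fin (d k) → X}
    (h : ∀ (g : G) (n : ℕ), ∀ᶠ k in atTop,
      1 - 1 / ((n : ℝ) + 1) ≤ unif {j | dist (φ k (σ k g j)) (g • φ k j) < 1 / ((n : ℝ) + 1)}) :
    IsTopologicalMicrostates d σ φ := by
  intro g U hU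
  refine tendsto_order.2 ⟨fun a ha => ?_, fun a ha =>
    Eventually.of_forall fun k => (unif_le_one _).trans_lt ha⟩
  obtain ⟨n, hn, hsub⟩ := exists_nat_dist_lt_subset hU (sub_pos.2 ha)
  filter_upwards [h g n] with k hk
  refine lt_of_lt_of_le (by linarith) (hk.trans (unif_mono fun j hj => hsub _ _ ?_))
  rw [dist_comm]
  exact hj

theorem IsTopologicalMicrostates.eventually_le [CompactSpace X] [SMul G X] (hd : ∀ k, 0 < d k)
    {φ : ∀ k, Fin (d k) → X} (hφ : IsTopologicalMicrostates d σ φ) (g : G) (n : ℕ) :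
    ∀ᶠ k in atTop, 1 - 1 / ((n : ℝ) + 1) ≤
      unif {j | dist (φ k (σ k g j)) (g • φ k j) < 1 / ((n : ℝ) + 1)} := by
  have hn : 0 < 1 / ((n : ℝ) + 1) := by positivity
  filter_upwards [(hφ.tendsto_unif_not_dist_lt hd g hn).eventually_lt_const hn] with k hk
  have h : unif {j | ¬ dist (g • φ k j) (φ k (σ k g j)) < 1 / ((n : ℝ) + 1)} =
      1 - unif {j | dist (g • φ k j) (φ k (σ k g j)) < 1 / ((n : ℝ) + 1)} :=
    unif_compl (hd k) _
  simp only [dist_comm (φ k _)]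
  linarith

end

/-! ### From measures to microstates and back -/

variable {G X : Type*} [MetricSpace X] [CompactSpace X] [MeasurableSpace X] [BorelSpace X]
  {d : ℕ → ℕ} {σ : ∀ k, G → Equiv.Perm (Fin (d k))}

theorem measurable_unif_mem [SMul G X] [ContinuousConstSMul G X] {d : ℕ}
    (p : Equiv.Perm (Fin d)) (g : G) {U : Set (X × X)} (hU : IsOpen U) :
    Measurable fun φ : Fin d → X => unif {j | (φ (p j), g • φ j) ∈ U} := by
  classical
  simp only [unif_eq_sum, Set.mem_ofPred_eq]
  refine Measurable.const_mul (Finset.measurable_sum _ fun j _ => ?_) _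
  refine Measurable.ite (IsOpen.measurableSet ?_) measurable_const measurable_const
  have hc : Continuous fun φ : Fin d → X => (φ (p j), g • φ j) := by fun_prop
  exact hU.preimage hc

theorem integral_average_eq {d : ℕ} (μ : ProbabilityMeasure (Fin d → X)) {f : X → ℝ}
    (hf : Continuous f) :
    ∫ φ, (1 / (d : ℝ)) * ∑ j, f (φ j) ∂(μ : Measure (Fin d → X)) =
      (1 / (d : ℝ)) * ∑ j, ∫ x, f x ∂(marginal μ j : Measure X) := by
  have hint (j : Fin d) : Integrable (fun φ : Fin d → X => f (φ j))
      (μ : Measure (Fin d → X)) :=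
    (BoundedContinuousFunction.mkOfCompact
      ⟨fun φ : Fin d → X => f (φ j), by fun_prop⟩).integrable _
  rw [integral_const_mul, integral_finsetSum _ fun j _ => hint j]
  congr 2 with j
  have h : (marginal μ j : Measure X) = (μ : Measure (Fin d → X)).map fun x => x j := rfl
  rw [h, integral_map (measurable_pi_apply j).aemeasurable hf.measurable.aestronglyMeasurable]

theorem exists_microstates_far [Countable G] [SMul G X] [ContinuousConstSMul G X]
    {μ : ∀ k, ProbabilityMeasure (Fin (d k) → X)}
    {ν : ProbabilityMeasure X} (hμ : AsympSupportedOnMicrostates d σ μ)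
    (hν : LocalWeakStarTendsto d μ ν) {f : X → ℝ} (hf : Continuous f) (hf0 : ∀ x, 0 ≤ f x)
    (hpos : 0 < ∫ x, f x ∂(ν : Measure X)) :
    ∃ φ : ∀ k, Fin (d k) → X, IsTopologicalMicrostates d σ φ ∧
      ∀ᶠ k in atTop, (∫ x, f x ∂(ν : Measure X)) / 8 ≤ (1 / (d k : ℝ)) * ∑ j, f (φ k j) := by
  classical
  set c := ∫ x, f x ∂(ν : Measure X)
  let F := BoundedContinuousFunction.mkOfCompact ⟨f, hf⟩
  set D := ‖F‖ + 1
  have hD0 : 0 < D := by positivity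
  have hfD (x : X) : f x ≤ D := by
    have : F x ≤ ‖F‖ := (le_abs_self _).trans (F.norm_coe_le_norm x)
    exact this.trans (by linarith)
  have hX : Nonempty X := ν.nonempty
  have hO : {ν' : ProbabilityMeasure X | c / 2 < ∫ x, f x ∂(ν' : Measure X)} ∈ 𝓝 ν :=
    (ProbabilityMeasure.tendsto_iff_forall_integral_tendsto.1 tendsto_id F).eventually_const_lt
      (half_lt_self hpos)
  let E (k : ℕ) : Set (Fin (d k) → X) := {φ | c / 8 ≤ (1 / (d k : ℝ)) * ∑ j, f (φ j)}
  have hEc (k : ℕ) : Continuous fun φ : Fin (d k) → X => (1 / (d k : ℝ)) * ∑ j, f (φ j) := by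
    fun_prop
  have hEm (k : ℕ) : MeasurableSet (E k) :=
    (isClosed_le continuous_const (hEc k)).measurableSet
  -- More than half the marginals have integral above `c / 2`, so the average has mean at least `c /
  -- 4`; this mean is at most `c / 8 + D * μ (E k)`.
  have hE : ∀ᶠ k in atTop, c / (8 * D) ≤ (μ k : Measure (Fin (d k) → X)).real (E k) := by
    filter_upwards [(hν _ hO).eventually_const_lt (show (1 / 2 : ℝ) < 1 by norm_num)] with k hk
    have h1 := mul_unif_le_average
      (fun j => ∫ x, f x ∂(marginal (μ k) j : Measure X)) (a := c / 2)
      fun j => integral_nonneg hf0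
    rw [← integral_average_eq _ hf] at h1
    have h2 : unif {j | marginal (μ k) j ∈
        {ν' : ProbabilityMeasure X | c / 2 < ∫ x, f x ∂(ν' : Measure X)}} ≤
        unif {j | c / 2 ≤ ∫ x, f x ∂(marginal (μ k) j : Measure X)} :=
      unif_mono fun j hj =>
        (show c / 2 < ∫ x, f x ∂(marginal (μ k) j : Measure X) from hj).le
    have h3 : c / 2 * (1 / 2) ≤
        c / 2 * unif {j | c / 2 ≤ ∫ x, f x ∂(marginal (μ k) j : Measure X)} := by
      gcongr
      exact hk.le.trans h2
    have h4 : ∫ φ, (1 / (d k : ℝ)) * ∑ j, f (φ j) ∂(μ k : Measure (Fin (d k) → X)) ≤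
        ∫ φ, c / 8 + (E k).indicator (fun _ => D) φ ∂(μ k : Measure (Fin (d k) → X)) := by
      refine integral_mono ?_ ?_ fun φ => ?_
      · exact (BoundedContinuousFunction.mkOfCompact ⟨_, hEc k⟩).integrable _
      · exact (integrable_const _).add ((integrable_const _).indicator (hEm k))
      · by_cases hφ : φ ∈ E k
        · have hav : (1 / (d k : ℝ)) * ∑ j, f (φ j) ≤ D := by
            calc _ ≤ (1 / (d k : ℝ)) * ∑ _j : Fin (d k), D := by
                  gcongr with j
                  exact hfD _
              _ ≤ D := by
                rw [Finset.sum_const, Finset.card_univ, Fintype.card_fin, nsmul_eq_mul,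
                  ← mul_assoc, one_div]
                exact mul_le_of_le_one_left hD0.le (inv_mul_le_one)
          simp only [Set.indicator_of_mem hφ]
          linarith
        · simp only [Set.indicator_of_notMem hφ, add_zero]
          exact (not_le.1 hφ).le
    rw [integral_add (integrable_const _) ((integrable_const _).indicator (hEm k)),
      integral_indicator_const _ (hEm k), integral_const, probReal_univ, one_smul,
      smul_eq_mul] at h4
    rw [div_le_iff₀ (by positivity)]
    linarith
  let S (i : G × ℕ) (k : ℕ) : Set (Fin (d k) → X) :=
    {φ | 1 - 1 / ((i.2 : ℝ) + 1) ≤ unif {j | (φ (σ k i.1 j), i.1 • φ j) ∈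
      {p : X × X | dist p.1 p.2 < 1 / ((i.2 : ℝ) + 1)}}}
  have hopen (n : ℕ) : IsOpen {p : X × X | dist p.1 p.2 < 1 / ((n : ℝ) + 1)} :=
    isOpen_lt (by fun_prop) continuous_const
  have hSm (i k) : MeasurableSet (S i k) :=
    measurableSet_le measurable_const (measurable_unif_mem _ _ (hopen _))
  have hS (i) : Tendsto (fun k => (μ k : Measure (Fin (d k) → X)).real (S i k)ᶜ) atTop (𝓝 0) := by
    have h1 := hμ i.1 _ (hopen i.2) (fun p hp => by
      rw [Set.mem_diagonal_iff] at hp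
      have : (0 : ℝ) < 1 / ((i.2 : ℝ) + 1) := by positivity
      simpa [hp] using this) (1 / ((i.2 : ℝ) + 1)) (by positivity)
    have h2 := (NNReal.tendsto_coe.2 h1).const_sub 1
    rw [NNReal.coe_one, sub_self] at h2
    refine h2.congr fun k => ?_
    rw [probReal_compl_eq_one_sub (hSm i k)]
    rfl
  -- `none` encodes being in `E k`, `some` the microstate conditions. Finitely many of the latter
  -- fail with vanishing probability, so the failures cannot cover `E k`.
  obtain ⟨φ, hφ⟩ := exists_forall_eventually_of_finset (ι := Option (G × ℕ))
    (β := fun k => Fin (d k) → X) (fun i k φ => φ ∈ i.elim (E k) fun i => S i k) (by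
      intro s
      have hsum : Tendsto (fun k => ∑ i ∈ s.eraseNone,
          (μ k : Measure (Fin (d k) → X)).real (S i k)ᶜ) atTop (𝓝 0) := by
        simpa using tendsto_finsetSum s.eraseNone fun i _ => hS i
      filter_upwards [hE, hsum.eventually_lt_const (show 0 < c / (8 * D) by positivity)]
        with k hk hk'
      by_contra! hcon
      have hsub : E k ⊆ ⋃ i ∈ s.eraseNone, (S i k)ᶜ := by
        intro φ hφ
        obtain ⟨i, his, hi⟩ := hcon φ
        cases i with
        | none => exact absurd hφ hi
        | some i => exact Set.mem_biUnion (Finset.mem_eraseNone.2 his) hi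
      have := (measureReal_mono hsub (measure_ne_top (μ k : Measure (Fin (d k) → X)) _)).trans
        (measureReal_biUnion_finset_le _ _)
      linarith)
  exact ⟨φ, isTopologicalMicrostates_of_eventually_le fun g n => hφ (some (g, n)), hφ none⟩

theorem integral_haarProb_pos [Group X] [IsTopologicalGroup X] {f : X → ℝ} (hf : Continuous f)
    (hf0 : ∀ x, 0 ≤ f x) {x : X} (hx : f x ≠ 0) : 0 < ∫ x, f x ∂(haarProb X : Measure X) := by
  rw [integral_pos_iff_support_of_nonneg hf0 (integrable_haarProb hf)]
  have : (haarProb X : Measure X).IsOpenPosMeasure :=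
    inferInstanceAs (Measure.haarMeasure _).IsOpenPosMeasure
  exact hf.isOpen_support.measure_pos _ ⟨x, hx⟩

theorem exists_measures_of_reachable [Group X] [IsTopologicalGroup X] [Group G] [Countable G]
    [MulDistribMulAction G X] (hd : ∀ k, 0 < d k) (herg : HasErgodicCommutant d σ)
    (hR : ∀ x : X, Reachable σ atTop x) :
    ∃ μ : ∀ k, ProbabilityMeasure (Fin (d k) → X),
      AsympSupportedOnMicrostates d σ μ ∧ LocalWeakStarTendsto d μ (haarProb X) := by
  obtain ⟨O, hO⟩ := (𝓝 (haarProb X)).exists_antitone_basis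
  have (k : ℕ) : Nonempty (ProbabilityMeasure (Fin (d k) → X)) :=
    ⟨familyMeasure fun _ : Unit => 1⟩
  obtain ⟨μ, hμ⟩ := exists_forall_eventually_of_finset (ι := G × ℕ)
    (β := fun k => ProbabilityMeasure (Fin (d k) → X))
    (fun i k μ => μ {φ | 1 - 1 / ((i.2 : ℝ) + 1) ≤
        unif {j | dist (φ (σ k i.1 j)) (i.1 • φ j) < 1 / ((i.2 : ℝ) + 1)}} = 1 ∧
      1 - 1 / ((i.2 : ℝ) + 1) ≤ unif {j | marginal μ j ∈ O i.2}) (by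
      intro s
      obtain ⟨I, _, _, φ, hφ, hm⟩ := exists_family_marginal_mem hd herg hR
        (hO.mem (s.sup Prod.snd)) (ε := 1 / (((s.sup Prod.snd : ℕ) : ℝ) + 1)) (by positivity)
      filter_upwards [hm, (eventually_all_finset s).2 fun i _ =>
        eventually_all.2 fun l => (hφ l).eventually_le hd i.1 i.2] with k hk hk'
      refine ⟨familyMeasure fun l => φ l k, fun i hi => ⟨familyMeasure_eq_one (hk' i hi), ?_⟩⟩
      have hle : i.2 ≤ s.sup Prod.snd := Finset.le_sup (f := Prod.snd) hi
      have hle' : 1 / (((s.sup Prod.snd : ℕ) : ℝ) + 1) ≤ 1 / ((i.2 : ℝ) + 1) := by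
        gcongr
      calc _ ≤ 1 - 1 / (((s.sup Prod.snd : ℕ) : ℝ) + 1) := by linarith
        _ ≤ _ := hk
        _ ≤ _ := unif_mono fun j hj => hO.antitone hle hj)
  refine ⟨μ, fun g U hU hdiag ε hε => ?_, fun V hV => ?_⟩
  · obtain ⟨n, hn, hsub⟩ := exists_nat_dist_lt_subset (hU.mem_nhdsSet.2 hdiag) hε
    refine tendsto_const_nhds.congr' ?_
    filter_upwards [hμ (g, n)] with k hk
    refine le_antisymm (hk.1.symm.trans_le ?_) (ProbabilityMeasure.apply_le_one _ _)
    refine ProbabilityMeasure.apply_mono _ fun φ hφ => ?_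
    have hφ' : 1 - 1 / ((n : ℝ) + 1) ≤
      unif {j | dist (φ (σ k g j)) (g • φ j) < 1 / ((n : ℝ) + 1)} := hφ
    exact (by linarith : 1 - ε ≤ 1 - 1 / ((n : ℝ) + 1)).trans
      (hφ'.trans (unif_mono fun j hj => hsub _ _ hj))
  · obtain ⟨m, hmV⟩ := hO.mem_iff.1 hV
    refine tendsto_order.2 ⟨fun a ha => ?_, fun a ha =>
      Eventually.of_forall fun k => (unif_le_one _).trans_lt ha⟩
    obtain ⟨n, hn⟩ := exists_nat_one_div_lt (sub_pos.2 ha)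
    -- The group element is irrelevant here; `m` places the basic neighbourhood inside `V`, and `n`
    -- controls the density error.
    filter_upwards [hμ (1, max m n)] with k hk
    have hle : 1 / (((max m n : ℕ) : ℝ) + 1) ≤ 1 / ((n : ℝ) + 1) := by
      gcongr
      exact le_max_right _ _
    have hmono : unif {j | marginal (μ k) j ∈ O (max m n)} ≤ unif {j | marginal (μ k) j ∈ V} :=
      unif_mono fun j hj => hmV (hO.antitone (le_max_left _ _) hj)
    linarith [hk.2]

end SoficAction

/-- `X` is a compact metrizable group and its compatible metric is the one of `MetricSpace X`. -/
theorem corollaryC {G : Type*} [Group G] [Countable G]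
    (d : ℕ → ℕ) (σ : ∀ k, G → Equiv.Perm (Fin (d k)))
    (hσ : SoficAction.IsSoficApproximation d σ)
    (herg : SoficAction.HasErgodicCommutant d σ)
    {X : Type*} [Group X] [MetricSpace X] [CompactSpace X] [IsTopologicalGroup X]
    [MeasurableSpace X] [BorelSpace X]
    [MulDistribMulAction G X] [ContinuousConstSMul G X] :
    (¬ ∃ μ : ∀ k, ProbabilityMeasure (Fin (d k) → X),
        SoficAction.AsympSupportedOnMicrostates d σ μ ∧
          SoficAction.LocalWeakStarTendsto d μ (SoficAction.haarProb X)) ↔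
      ∃ Y : Subgroup X, Y ≠ ⊤ ∧ IsClosed (Y : Set X) ∧ (∀ g : G, ∀ y ∈ Y, g • y ∈ Y) ∧
        ∀ φ : ∀ k, Fin (d k) → X, SoficAction.IsTopologicalMicrostates d σ φ →
          ∃ κ : ℕ → ℕ, StrictMono κ ∧
            Tendsto (fun l => SoficAction.rho2ToPow (φ (κ l)) (Y : Set X)) atTop (𝓝 0) := by
  constructor
  · intro h
    by_cases hR : ∀ x : X, SoficAction.Reachable σ atTop x
    · exact absurd (SoficAction.exists_measures_of_reachable hσ.pos herg hR) h
    · push Not at hR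
      obtain ⟨x, hx⟩ := hR
      exact SoficAction.exists_subgroup_of_not_reachable hσ.pos herg hx
  · rintro ⟨Y, hY, hYc, -, hφ⟩ ⟨μ, hμ, hloc⟩
    have hYne : (Y : Set X).Nonempty := ⟨1, one_mem Y⟩
    obtain ⟨x, hx⟩ : ∃ x, x ∉ Y := by
      by_contra! hall
      exact hY ((Subgroup.eq_top_iff' Y).2 hall)
    have hf : Continuous fun x => Metric.infDist x (Y : Set X) ^ 2 :=
      (Metric.continuous_infDist_pt _).pow 2
    have hpos := SoficAction.integral_haarProb_pos hf (fun _ => sq_nonneg _) (x := x)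
      (pow_ne_zero 2 ((hYc.notMem_iff_infDist_pos hYne).1 hx).ne')
    obtain ⟨φ, hmic, hfar⟩ :=
      SoficAction.exists_microstates_far hμ hloc hf (fun _ => sq_nonneg _) hpos
    have hpos8 := div_pos hpos (show (0 : ℝ) < 8 by norm_num)
    obtain ⟨κ, hκ, hlim⟩ := hφ φ hmic
    have hlim' := hlim.pow 2
    rw [zero_pow two_ne_zero] at hlim'
    obtain ⟨l, hl, hl'⟩ := ((hlim'.eventually_lt_const hpos8).and
      (hκ.tendsto_atTop.eventually hfar)).exists
    exact (hl'.trans (SoficAction.average_infDist_sq_le_rho2ToPow_sq _ hYne)).not_gt hl
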